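/- Let $K$ be a field. A weighted oriented graph $D$ is an orientation of a finite simple graph on a vertex set $V(D)$ together with a weight function $w:V(D)\to\{1,2,3,\dots\}$; we write $(u,v)\in E(D)$ for an edge directed from $u$ to $v$. Its edge ideal is $I(D)=\langle uv^{w(v)} : (u,v)\in E(D)\rangle$ in the polynomial ring $K[V(D)]$, and $D$ is called Cohen–Macaulay if the ring $K[V(D)]/I(D)$ is Cohen–Macaulay. Let $D_H$ be a weighted oriented graph with vertices $x_1,\dots,x_n,z,y$ and underlying graph $H$. Suppose that $\deg(y)=1$, that $\deg(z)\ge 2$, that the neighbours of $z$ in $H$ are exactly $x_1,\dots,x_k,y$, that $(x_i,z)\in E(D_H)$ for $i=1,\dots,k$, and that $(y,z)\in E(D_H)$. Let $D_G=D_H\setminus\{z,y\}$, with underlying graph $G$, and $D_F=D_G\setminus\{x_1,\dots,x_k\}$ be the weighted oriented graphs obtained by deleting the indicated vertices. If $D_F$ and $D_G$ are Cohen–Macaulay and $\{x_1,\dots,x_k\}$ is contained in some (inclusion-)minimal vertex cover of $G$, then $D_H$ is Cohen–Macaulay. -/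

import Mathlib

/-- The depth of a local ring `R`: the supremum of the lengths of the `R`-regular sequences that
consist of elements of the maximal ideal. -/
noncomputable def localRingDepth (R : Type*) [CommRing R] [IsLocalRing R] : ℕ∞ :=
  ⨆ rs ∈ {rs : List R | (∀ r ∈ rs, r ∈ IsLocalRing.maximalIdeal R) ∧
    RingTheory.Sequence.IsRegular R rs}, (rs.length : ℕ∞)

/-- A Cohen–Macaulay local ring: a Noetherian local ring whose depth equals its Krull dimension. -/
structure IsCohenMacaulayLocalRing (R : Type*) [CommRing R] [IsLocalRing R] : Prop where
  isNoetherianRing : IsNoetherianRing R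
  depth_eq_dim : (localRingDepth R : WithBot ℕ∞) = ringKrullDim R

/-- A Cohen–Macaulay ring: a Noetherian ring all of whose localizations at maximal ideals are
Cohen–Macaulay local rings. -/
structure IsCohenMacaulayRing (R : Type*) [CommRing R] : Prop where
  isNoetherianRing : IsNoetherianRing R
  localization : ∀ (m : Ideal R) [m.IsMaximal],
    IsCohenMacaulayLocalRing (Localization.AtPrime m)

/-- A weighted oriented graph on the vertex set `V`: a digraph without loops and without pairs of
opposite edges (an orientation of a simple graph), together with a positive integer weight at
every vertex. `D.Adj u v` means that the ordered pair `(u, v)` is an edge of `D`. -/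
structure WeightedOrientedGraph (V : Type*) extends Digraph V where
  asymm : ∀ u v : V, Adj u v → ¬ Adj v u
  weight : V → ℕ
  weight_pos : ∀ v : V, 0 < weight v

namespace WeightedOrientedGraph

/-- The underlying simple graph of a weighted oriented graph. -/
def underlying {V : Type*} (D : WeightedOrientedGraph V) : SimpleGraph V where
  Adj u v := D.Adj u v ∨ D.Adj v u
  symm := ⟨fun _ _ h => h.symm⟩
  loopless := ⟨fun v h => h.elim (fun h => D.asymm v v h h) (fun h => D.asymm v v h h)⟩

/-- The weighted oriented graph `D ∖ S`, obtained from `D` by deleting the vertices in `S`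
together with all the edges at them. -/
def deleteVerts {V : Type*} (D : WeightedOrientedGraph V) (S : Set V) :
    WeightedOrientedGraph {v : V // v ∉ S} where
  Adj u v := D.Adj u v
  asymm u v h := D.asymm u v h
  weight v := D.weight v
  weight_pos v := D.weight_pos v

/-- The edge ideal `I(D) = ⟨x_u * x_v ^ w(v) : (u, v) ∈ E(D)⟩` in `K[x_v : v ∈ V]`. -/
noncomputable def edgeIdeal {V : Type*} (K : Type*) [Field K] (D : WeightedOrientedGraph V) :
    Ideal (MvPolynomial V K) :=
  Ideal.span {f | ∃ u v : V, D.Adj u v ∧ f = MvPolynomial.X u * MvPolynomial.X v ^ D.weight v}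

/-- `D` is Cohen–Macaulay (over `K`) if the quotient ring `K[x_v : v ∈ V] / I(D)` is. -/
def IsCohenMacaulay {V : Type*} (K : Type*) [Field K] (D : WeightedOrientedGraph V) : Prop :=
  IsCohenMacaulayRing (MvPolynomial V K ⧸ D.edgeIdeal K)

end WeightedOrientedGraph

/-! ### Depth of modules over a Noetherian local ring. -/

section

open RingTheory.Sequence IsLocalRing CategoryTheory CategoryTheory.Abelian

universe u

/-! Write `R = K[V]`, `I = I(D_H)` and `w` for the weight of `z`. The vertex `z` is a sink whose
in-neighbours are `X` and the leaf `y`. Hence `I : z^w` is generated by `I(D_F)`, `X` and `y`, and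
`R/(I : z^w)` is the polynomial ring in `z` over the graph ring of `D_F`. Put `J_i = I + (z^i)`. For
`i < w` one has `J_{i+1} : z = J_i` and `J_{i+1} + (z) = J_1`, and `R/J_1` is the polynomial ring in
`y` over the graph ring of `D_G`. The depth lemma for `0 → R/(J : g) → R/J → R/(J + (g)) → 0` climbs
from `J_1` to `J_w = I + (z^w)` and then to `I` (`IsWhiskeredSink.hasDepthGE_edgeIdeal`).

Let `C ⊇ X` be the given minimal cover of `G` and `d` the number of vertices of `G` outside `C`.
Cohen–Macaulay graph rings are unmixed (`IsCohenMacaulay.card_compl_le`): no vertex cover omits more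
vertices than a minimal one. So the graph ring of `D_G` has depth at least `d` at every maximal
ideal. So has that of `D_F`, because `C \ X` covers `F` and omits the same `d` vertices. Thus `R/I`
has depth at least `d + 1` at every maximal ideal where it is nonzero. A vertex cover of `H`
contains `z` or `y` and restricts to a cover of `G`, so it omits at most `d + 1` vertices and `dim
R/I ≤ d + 1`. -/

/-- The depth of the module `Q` over the local ring `L` is at least `d`
(the zero module has infinite depth). -/
def HasDepthGE (L Q : Type*) [CommRing L] [IsLocalRing L] [AddCommGroup Q] [Module L Q]
    (d : ℕ) : Prop :=
  ∃ rs : List L, rs.length = d ∧ (∀ r ∈ rs, r ∈ maximalIdeal L) ∧ IsWeaklyRegular Q rs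

section Depth

variable {L : Type u} [CommRing L] [IsLocalRing L]

theorem HasDepthGE.of_subsingleton {Q : Type*} [AddCommGroup Q] [Module L Q] [Subsingleton Q]
    (d : ℕ) : HasDepthGE L Q d :=
  ⟨List.replicate d 0, by simp, fun r hr => by simp [List.eq_of_mem_replicate hr],
    ⟨fun _ _ _ _ _ => Subsingleton.elim _ _⟩⟩

theorem HasDepthGE.mono {Q : Type*} [AddCommGroup Q] [Module L Q] {d d' : ℕ}
    (h : HasDepthGE L Q d) (hd : d' ≤ d) : HasDepthGE L Q d' := by
  obtain ⟨rs, rfl, hm, hw⟩ := h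
  refine ⟨rs.take d', by simpa, fun r hr => hm r (List.mem_of_mem_take hr), ?_⟩
  rw [← List.take_append_drop d' rs, isWeaklyRegular_append_iff] at hw
  exact hw.1

/-- Rees' criterion, which makes depth accessible to long exact sequences. Nakayama's lemma supplies
its properness hypothesis when `Q` is nonzero. -/
theorem hasDepthGE_iff_subsingleton_ext [IsNoetherianRing L] (Q : ModuleCat.{u} L)
    [Module.Finite L Q] (d : ℕ) :
    HasDepthGE L Q d ↔ ∀ i < d,
      Subsingleton (Ext (ModuleCat.of L (Shrink.{u} (L ⧸ maximalIdeal L))) Q i) := by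
  cases subsingleton_or_nontrivial Q with
  | inl h =>
    refine iff_of_true (.of_subsingleton d) fun i _ => ?_
    exact AddCommGrpCat.subsingleton_of_isZero
      (((extFunctorObj (ModuleCat.of L (Shrink.{u} (L ⧸ maximalIdeal L))) i).map_isZero
        (ModuleCat.isZero_of_subsingleton Q)))
  | inr h =>
    have hlt : maximalIdeal L • (⊤ : Submodule L Q) < ⊤ :=
      (Submodule.top_ne_ideal_smul_of_le_jacobson_annihilator
        (maximalIdeal_le_jacobson _)).symm.lt_top
    rw [(ModuleCat.exists_isRegular_tfae (maximalIdeal L) d Q hlt).out 1 3 rfl rfl]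
    refine exists_congr fun rs => and_congr_right fun _ => and_congr_right fun hm => ?_
    exact ⟨fun h => .of_isWeaklyRegular_of_mem_maximalIdeal Q hm h, fun h => h.1⟩

theorem HasDepthGE.of_shortExact [IsNoetherianRing L] {S : ShortComplex (ModuleCat.{u} L)}
    (hS : S.ShortExact) [Module.Finite L S.X₁] [Module.Finite L S.X₂] [Module.Finite L S.X₃]
    {d : ℕ} (h₁ : HasDepthGE L S.X₁ d) (h₃ : HasDepthGE L S.X₃ d) : HasDepthGE L S.X₂ d := by
  rw [hasDepthGE_iff_subsingleton_ext] at *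
  intro i hi
  have z₁ := AddCommGrpCat.isZero_of_iff_subsingleton.mpr (h₁ i hi)
  have z₃ := AddCommGrpCat.isZero_of_iff_subsingleton.mpr (h₃ i hi)
  exact AddCommGrpCat.subsingleton_of_isZero <| ShortComplex.Exact.isZero_of_both_zeros
    (Ext.covariant_sequence_exact₂' _ hS i) (z₁.eq_zero_of_src _) (z₃.eq_zero_of_tgt _)

/-- The depth lemma for `0 → L ⧸ (J : g) → L ⧸ J → L ⧸ (J + (g)) → 0`. -/
theorem HasDepthGE.quotient_of_colon [IsNoetherianRing L] {J J₁ : Ideal L} {g : L}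
    (hg : ∀ x, x * g ∈ J ↔ x ∈ J₁) {d : ℕ} (h₁ : HasDepthGE L (L ⧸ J₁) d)
    (h₃ : HasDepthGE L (L ⧸ (J ⊔ Ideal.span {g})) d) : HasDepthGE L (L ⧸ J) d := by
  have hle₁ : J₁ ≤ Submodule.comap (LinearMap.mulRight L g) J := fun x hx => (hg x).2 hx
  have hle₂ : J ≤ Submodule.comap LinearMap.id (J ⊔ Ideal.span {g}) :=
    fun x hx => Submodule.mem_sup_left hx
  let f : (L ⧸ J₁) →ₗ[L] (L ⧸ J) := Submodule.mapQ J₁ J (LinearMap.mulRight L g) hle₁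
  let p : (L ⧸ J) →ₗ[L] (L ⧸ (J ⊔ Ideal.span {g})) := Submodule.mapQ J _ LinearMap.id hle₂
  have hf (a : L) : f (Submodule.Quotient.mk a) = Submodule.Quotient.mk (a * g) := rfl
  have hp (a : L) : p (Submodule.Quotient.mk a) = Submodule.Quotient.mk a := rfl
  have hfi : Function.Injective f := by
    rw [injective_iff_map_eq_zero]
    intro x
    obtain ⟨x, rfl⟩ := Submodule.Quotient.mk_surjective _ x
    rw [hf, Submodule.Quotient.mk_eq_zero, Submodule.Quotient.mk_eq_zero]
    exact (hg x).1
  have hps : Function.Surjective p := by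
    intro x
    obtain ⟨x, rfl⟩ := Submodule.Quotient.mk_surjective _ x
    exact ⟨Submodule.Quotient.mk x, rfl⟩
  have hfp : Function.Exact f p := by
    intro y
    obtain ⟨y, rfl⟩ := Submodule.Quotient.mk_surjective _ y
    constructor
    · intro h
      rw [hp, Submodule.Quotient.mk_eq_zero] at h
      obtain ⟨j, hj, b, hb, rfl⟩ := Submodule.mem_sup.1 h
      obtain ⟨a, rfl⟩ := Ideal.mem_span_singleton'.1 hb
      refine ⟨Submodule.Quotient.mk a, ?_⟩
      rw [hf, Submodule.Quotient.eq]
      simpa using hj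
    · rintro ⟨x, hx⟩
      obtain ⟨x, rfl⟩ := Submodule.Quotient.mk_surjective _ x
      rw [← hx, hf, hp, Submodule.Quotient.mk_eq_zero]
      exact Submodule.mem_sup_right (Ideal.mem_span_singleton'.2 ⟨x, rfl⟩)
  let S : ShortComplex (ModuleCat.{u} L) := ShortComplex.mk (ModuleCat.ofHom f) (ModuleCat.ofHom p)
    (by rw [← ModuleCat.ofHom_comp, hfp.linearMap_comp_eq_zero]; rfl)
  have hS : S.ShortExact :=
    { exact := (ShortComplex.ShortExact.moduleCat_exact_iff_function_exact S).2 hfp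
      mono_f := (ModuleCat.mono_iff_injective _).2 hfi
      epi_g := (ModuleCat.epi_iff_surjective _).2 hps }
  have : Module.Finite L S.X₁ := inferInstanceAs (Module.Finite L (L ⧸ J₁))
  have : Module.Finite L S.X₂ := inferInstanceAs (Module.Finite L (L ⧸ J))
  have : Module.Finite L S.X₃ := inferInstanceAs (Module.Finite L (L ⧸ (J ⊔ Ideal.span {g})))
  exact HasDepthGE.of_shortExact hS h₁ h₃

/-- The length of a regular sequence on `M` is at most the dimension of `L ⧸ P` for every prime
ideal `P` that kills a nonzero element of `M`. -/
theorem length_le_ringKrullDim_quotient [IsNoetherianRing L] {M : Type*} [AddCommGroup M]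
    [Module L M] [Module.Finite L M] {rs : List L} (hm : ∀ r ∈ rs, r ∈ maximalIdeal L)
    (hrs : IsWeaklyRegular M rs) {P : Ideal L} [P.IsPrime] {u : M} (hu : u ≠ 0)
    (hP : ∀ r ∈ P, r • u = 0) : (rs.length : WithBot ℕ∞) ≤ ringKrullDim (L ⧸ P) := by
  induction rs generalizing M P with
  | nil => simpa using ringKrullDim_nonneg_of_nontrivial
  | cons x rs ih =>
    rw [isWeaklyRegular_cons_iff] at hrs
    -- The induction passes to `M / xM` and to a larger prime. For this, some element killed by `P`
    -- must survive modulo `x`.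
    let N : Submodule L M :=
      { carrier := {v | ∀ r ∈ P, r • v = 0}
        add_mem' := fun {a b} ha hb r hr => by rw [smul_add, ha r hr, hb r hr, add_zero]
        zero_mem' := fun r _ => smul_zero r
        smul_mem' := fun c a ha r hr => by rw [smul_comm, ha r hr, smul_zero] }
    have hN : ∃ v ∈ N, (Submodule.Quotient.mk v : QuotSMulTop x M) ≠ 0 := by
      by_contra! hcon
      -- If `x • w` is killed by `P`, so is `w`, because `x` is regular. So `N ⊆ xM` would force `N
      -- = xN`, hence `N = 0` by Nakayama, against `u ∈ N`.
      have : N ≤ Ideal.span {x} • N := by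
        intro v hv
        have := hcon v hv
        rw [Submodule.Quotient.mk_eq_zero, Submodule.mem_smul_pointwise_iff_exists] at this
        obtain ⟨w, -, rfl⟩ := this
        refine Submodule.smul_mem_smul (Ideal.mem_span_singleton_self x) fun r hr => ?_
        exact hrs.1.right_eq_zero_of_smul (by rw [smul_comm]; exact hv r hr)
      have hb := Submodule.eq_bot_of_le_smul_of_le_jacobson_bot (Ideal.span {x}) N
        (IsNoetherian.noetherian N) this
        ((Ideal.span_singleton_le_iff_mem _).2
          (maximalIdeal_le_jacobson _ (hm x List.mem_cons_self)))
      exact hu ((Submodule.eq_bot_iff N).1 hb u hP)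
    obtain ⟨v, hv, hv0⟩ := hN
    obtain ⟨Q, hQ, hQv⟩ := exists_le_isAssociatedPrime_of_isNoetherianRing L
      (Submodule.Quotient.mk v : QuotSMulTop x M) hv0
    have hQp : Q.IsPrime := hQ.isPrime
    have hPQ : P ≤ Q := fun r hr => hQv <| by
      rw [Submodule.mem_colon_singleton, ← Submodule.Quotient.mk_smul, hv r hr]; simp
    have hxQ : x ∈ Q := hQv <| by
      rw [Submodule.mem_colon_singleton, ← Submodule.Quotient.mk_smul, Submodule.mem_bot,
        Submodule.Quotient.mk_eq_zero]
      exact Submodule.smul_mem_pointwise_smul _ _ _ trivial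
    have hxP : x ∉ P := fun h => hu (hrs.1.right_eq_zero_of_smul (hP x h))
    obtain ⟨y, hann⟩ := (isAssociatedPrime_iff.1 hQ).2
    have hy0 : y ≠ 0 := by
      rintro rfl
      exact hQp.ne_top (by simp [hann])
    have key := ih (fun r hr => hm r (List.mem_cons_of_mem _ hr)) hrs.2 (P := Q) hy0
      fun r hr => by rwa [hann, Submodule.mem_colon_singleton, Submodule.mem_bot] at hr
    -- `Q` contains `P` and also `x ∉ P`, so the dimension drops by at least one.
    have hdim := ringKrullDim_succ_le_of_surjective (Ideal.Quotient.factor hPQ)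
      (Ideal.Quotient.factor_surjective hPQ) (r := Ideal.Quotient.mk P x)
      (mem_nonZeroDivisors_of_ne_zero (by rwa [Ne, Ideal.Quotient.eq_zero_iff_mem]))
      (by simpa [Ideal.Quotient.eq_zero_iff_mem] using hxQ)
    refine le_trans ?_ hdim
    rw [List.length_cons, Nat.cast_add, Nat.cast_one]
    gcongr

end Depth

end

/-! ### Depth under localized quotients and polynomial extensions; the Cohen–Macaulay criterion. -/

section

open RingTheory.Sequence IsLocalRing

theorem ideal_smul_top_eq_self {R : Type*} [CommRing R] (I : Ideal R) :
    (I • (⊤ : Submodule R R)) = I := by simp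

section Transfer

universe u

variable {R T : Type u} [CommRing R] [CommRing T]

/-- Localizing a surjection `R → T` at a prime ideal of `T`. -/
noncomputable def localizationAtPrimeQuotientEquiv (φ : R →+* T) (hφ : Function.Surjective φ) (n : Ideal T)
    [n.IsPrime] (m : Ideal R) [m.IsPrime] (hm : m = n.comap φ) :
    (Localization.AtPrime m ⧸ (RingHom.ker φ).map (algebraMap R (Localization.AtPrime m))) ≃+*
      Localization.AtPrime n :=
  have hT : m.primeCompl.map φ = n.primeCompl := by
    ext x
    obtain ⟨x, rfl⟩ := hφ x
    subst hm
    constructor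
    · rintro ⟨y, hy, hxy⟩
      rw [← hxy]
      exact hy
    · exact fun h => ⟨x, h, rfl⟩
  have hs : Function.Surjective (Localization.localRingHom m n φ hm) := by
    subst hm
    exact RingHom.surjective_localRingHom_of_surjective φ hφ n
  have hk : RingHom.ker (Localization.localRingHom m n φ hm) =
      (RingHom.ker φ).map (algebraMap R (Localization.AtPrime m)) :=
    IsLocalization.ker_map (S := Localization.AtPrime m) (Localization.AtPrime n) φ hT
  (Ideal.quotEquivOfEq hk.symm).trans (RingHom.quotientKerEquivOfSurjective hs)

theorem localizationAtPrimeQuotientEquiv_mk (φ : R →+* T) (hφ : Function.Surjective φ) (n : Ideal T)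
    [n.IsPrime] (m : Ideal R) [m.IsPrime] (hm : m = n.comap φ) (x : Localization.AtPrime m) :
    localizationAtPrimeQuotientEquiv φ hφ n m hm (Ideal.Quotient.mk _ x) =
      Localization.localRingHom m n φ hm x := rfl

theorem forall₂_localizationAtPrimeQuotientEquiv (φ : R →+* T) (hφ : Function.Surjective φ) (n : Ideal T)
    [n.IsPrime] (m : Ideal R) [m.IsPrime] (hm : m = n.comap φ) (rs : List (Localization.AtPrime m)) :
    List.Forall₂ (fun r s => ∀ x, (localizationAtPrimeQuotientEquiv φ hφ n m hm).toAddEquiv (r • x) =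
      s • (localizationAtPrimeQuotientEquiv φ hφ n m hm).toAddEquiv x) rs
      (rs.map (Localization.localRingHom m n φ hm)) := by
  rw [List.forall₂_map_right_iff]
  refine List.forall₂_same.2 fun r _ x => ?_
  obtain ⟨x, rfl⟩ := Ideal.Quotient.mk_surjective x
  change localizationAtPrimeQuotientEquiv φ hφ n m hm (Ideal.Quotient.mk _ (r * x)) =
    _ * localizationAtPrimeQuotientEquiv φ hφ n m hm (Ideal.Quotient.mk _ x)
  simp only [localizationAtPrimeQuotientEquiv_mk, map_mul]

/-- The local map `R_m → T_n` is surjective, so regular sequences on `T_n` can be pushed forward and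
lifted back along it. -/
theorem hasDepthGE_localization_quotient_iff (φ : R →+* T) (hφ : Function.Surjective φ)
    (n : Ideal T) [n.IsPrime] (m : Ideal R) [m.IsPrime] (hm : m = n.comap φ) (d : ℕ) :
    HasDepthGE (Localization.AtPrime m) (Localization.AtPrime m ⧸
        (RingHom.ker φ).map (algebraMap R (Localization.AtPrime m))) d ↔
      HasDepthGE (Localization.AtPrime n) (Localization.AtPrime n) d := by
  have hloc := Localization.isLocalHom_localRingHom m n φ hm
  have hmem : ∀ r, Localization.localRingHom m n φ hm r ∈ maximalIdeal _ ↔ r ∈ maximalIdeal _ :=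
    fun r => by simp [mem_maximalIdeal, mem_nonunits_iff]
  constructor
  · rintro ⟨rs, hl, hrs, hw⟩
    refine ⟨rs.map (Localization.localRingHom m n φ hm), by simpa, ?_, ?_⟩
    · simpa [hmem] using hrs
    · exact (AddEquiv.isWeaklyRegular_congr (forall₂_localizationAtPrimeQuotientEquiv φ hφ n m hm rs)).1 hw
  · rintro ⟨rs, hl, hrs, hw⟩
    have hs : Function.Surjective (Localization.localRingHom m n φ hm) := by
      subst hm
      exact RingHom.surjective_localRingHom_of_surjective φ hφ n
    obtain ⟨rs, rfl⟩ := (List.map_surjective_iff.2 hs) rs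
    refine ⟨rs, by simpa using hl, ?_, ?_⟩
    · simpa [hmem] using hrs
    · exact (AddEquiv.isWeaklyRegular_congr (forall₂_localizationAtPrimeQuotientEquiv φ hφ n m hm rs)).2 hw

theorem hasDepthGE_localization_quotient_ker (φ : R →+* T) (hφ : Function.Surjective φ) {d : ℕ}
    (h : ∀ (n : Ideal T) [n.IsMaximal],
      HasDepthGE (Localization.AtPrime n) (Localization.AtPrime n) d)
    (m : Ideal R) [m.IsMaximal] :
    HasDepthGE (Localization.AtPrime m) (Localization.AtPrime m ⧸
        (RingHom.ker φ).map (algebraMap R (Localization.AtPrime m))) d := by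
  by_cases hle : RingHom.ker φ ≤ m
  · have hc : (m.map φ).comap φ = m := by
      rw [Ideal.comap_map_of_surjective φ hφ, sup_eq_left]
      exact hle
    have : (m.map φ).IsMaximal := by
      refine (Ideal.map_eq_top_or_isMaximal_of_surjective φ hφ ‹_›).resolve_left fun htop => ?_
      rw [htop, Ideal.comap_top] at hc
      exact (Ideal.IsMaximal.ne_top ‹_›) hc.symm
    exact (hasDepthGE_localization_quotient_iff φ hφ (m.map φ) m hc.symm d).2 (h _)
  -- Away from the zero locus of the kernel the localized quotient is zero.
  · obtain ⟨x, hx, hxm⟩ := Set.not_subset.1 hle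
    have htop : (RingHom.ker φ).map (algebraMap R (Localization.AtPrime m)) = ⊤ :=
      Ideal.eq_top_of_isUnit_mem _ (Ideal.mem_map_of_mem _ hx)
        (IsLocalization.map_units _ (⟨x, hxm⟩ : m.primeCompl))
    have := Ideal.Quotient.subsingleton_iff.2 htop
    exact .of_subsingleton d

end Transfer

section Polynomial

open Polynomial

variable {C : Type*} [CommRing C]

/-- Over a Jacobson ring `C[X] / n` is integral over `C`; an integral equation for the class of `X`
is the required polynomial. -/
theorem exists_monic_mem_of_isMaximal [IsJacobsonRing C] (n : Ideal C[X]) [n.IsMaximal] :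
    ∃ f ∈ n, f.Monic := by
  obtain ⟨f, hf, h⟩ := Polynomial.quotient_mk_comp_C_isIntegral_of_isJacobsonRing n
    (Ideal.Quotient.mk n X)
  refine ⟨f, ?_, hf⟩
  rwa [← Polynomial.hom_eval₂, eval₂_C_X, Ideal.Quotient.eq_zero_iff_mem] at h

theorem mem_map_C_of_monic_mul_mem {J : Ideal C} {f g : C[X]} (hf : f.Monic)
    (h : f * g ∈ J.map (Polynomial.C : C →+* C[X])) : g ∈ J.map (Polynomial.C : C →+* C[X]) := by
  have key : ∀ p : C[X], p ∈ J.map (Polynomial.C : C →+* C[X]) ↔ p.map (Ideal.Quotient.mk J) = 0 := by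
    intro p
    rw [Ideal.mem_map_C_iff, Polynomial.ext_iff]
    simp [Ideal.Quotient.eq_zero_iff_mem]
  rw [key, Polynomial.map_mul] at h
  rw [key]
  exact (hf.map _).isRegular.left (by simpa using h)

/-- A regular sequence of `C_p` stays regular under the flat local map `C_p → C[X]_n`. A monic
element of `n` extends it, being a nonzerodivisor modulo every ideal extended from `C`. -/
theorem hasDepthGE_polynomial [IsJacobsonRing C] {d : ℕ}
    (h : ∀ (p : Ideal C) [p.IsMaximal],
      HasDepthGE (Localization.AtPrime p) (Localization.AtPrime p) d)
    (n : Ideal C[X]) [n.IsMaximal] :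
    HasDepthGE (Localization.AtPrime n) (Localization.AtPrime n) (d + 1) := by
  let p : Ideal C := n.comap (Polynomial.C : C →+* C[X])
  have hp : p.IsMaximal := Polynomial.isMaximal_comap_C_of_isJacobsonRing n
  let ψ := Localization.localRingHom p n (Polynomial.C : C →+* C[X]) rfl
  have hψ : IsLocalHom ψ := Localization.isLocalHom_localRingHom _ _ _ _
  have hψC (c : C) : ψ (algebraMap C _ c) = algebraMap C[X] _ (Polynomial.C c) :=
    Localization.localRingHom_to_map _ _ _ _ _
  let _ : Algebra (Localization.AtPrime p) (Localization.AtPrime n) := ψ.toAlgebra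
  have : IsScalarTower C (Localization.AtPrime p) (Localization.AtPrime n) :=
    IsScalarTower.of_algebraMap_eq fun c => by
      rw [RingHom.algebraMap_toAlgebra, hψC, IsScalarTower.algebraMap_apply C C[X]]
      rfl
  have : Module.Flat (Localization.AtPrime p) (Localization.AtPrime n) :=
    (Module.flat_iff_of_isLocalization _ p.primeCompl _).2 inferInstance
  obtain ⟨rs, hl, hm, hw⟩ := h p
  obtain ⟨f, hfn, hf⟩ := exists_monic_mem_of_isMaximal n
  refine ⟨rs.map ψ ++ [algebraMap C[X] _ f], by simp [hl], ?_, ?_⟩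
  · intro r hr
    rw [List.mem_append, List.mem_map, List.mem_singleton] at hr
    obtain ⟨s, hs, rfl⟩ | rfl := hr
    · have := hm s hs
      simpa [mem_maximalIdeal, mem_nonunits_iff] using this
    · exact (IsLocalization.AtPrime.to_map_mem_maximal_iff _ n f).2 hfn
  · rw [isWeaklyRegular_append_iff]
    refine ⟨hw.of_flat, (isWeaklyRegular_singleton_iff _ _).2 ?_⟩
    -- Contracting to `C` exhibits the ideal of the sequence as extended from `C`, so that
    -- regularity can be checked in `C[X]`.
    let J : Ideal C := (Ideal.ofList rs).comap (algebraMap C (Localization.AtPrime p))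
    have hJ : Ideal.ofList (rs.map ψ) =
        (J.map (Polynomial.C : C →+* C[X])).map (algebraMap C[X] (Localization.AtPrime n)) := by
      rw [← Ideal.map_ofList, ← IsLocalization.map_under p.primeCompl (Localization.AtPrime p)
        (Ideal.ofList rs), Ideal.map_map, Ideal.map_map]
      congr 1
      ext c
      exact hψC c
    rw [isSMulRegular_quotient_iff_mem_of_smul_mem, ideal_smul_top_eq_self, hJ]
    intro x hx
    obtain ⟨g, s, rfl⟩ := IsLocalization.exists_mk'_eq n.primeCompl x
    rw [smul_eq_mul, IsLocalization.mul_mk'_eq_mk'_of_mul,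
      IsLocalization.mk'_mem_map_algebraMap_iff] at hx
    obtain ⟨t, ht, htx⟩ := hx
    rw [IsLocalization.mk'_mem_map_algebraMap_iff]
    exact ⟨t, ht, mem_map_C_of_monic_mul_mem hf (by rwa [mul_left_comm])⟩

end Polynomial

section CohenMacaulay

variable {L : Type*} [CommRing L] [IsLocalRing L]

theorem IsCohenMacaulayLocalRing.hasDepthGE (h : IsCohenMacaulayLocalRing L) {d : ℕ}
    (hd : (d : WithBot ℕ∞) ≤ ringKrullDim L) : HasDepthGE L L d := by
  rw [← h.depth_eq_dim] at hd
  have hd' : (d : ℕ∞) ≤ localRingDepth L := by exact_mod_cast hd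
  cases d with
  | zero => exact ⟨[], rfl, by simp, .nil _ _⟩
  -- As `d < depth`, a single regular sequence already has length greater than `d`.
  | succ d =>
    have hlt : (d : ℕ∞) < localRingDepth L :=
      lt_of_lt_of_le (by exact_mod_cast Nat.lt_succ_self d) hd'
    obtain ⟨rs, hrs⟩ := lt_iSup_iff.1 hlt
    obtain ⟨⟨hm, hreg⟩, hlen⟩ := lt_iSup_iff.1 hrs
    have hlen : d + 1 ≤ rs.length := by exact_mod_cast hlen
    exact HasDepthGE.mono ⟨rs, rfl, hm, hreg.1⟩ hlen

theorem IsCohenMacaulayLocalRing.of_hasDepthGE [IsNoetherianRing L] {d : ℕ} (h : HasDepthGE L L d)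
    (hd : ringKrullDim L ≤ d) : IsCohenMacaulayLocalRing L := by
  refine ⟨inferInstance, le_antisymm ?_ ?_⟩
  · have hne : (0 : WithBot ℕ∞) ≤ ringKrullDim L := ringKrullDim_nonneg_of_nontrivial
    obtain ⟨n, hn⟩ := WithBot.ne_bot_iff_exists.1 (ne_bot_of_le_ne_bot (by simp) hne)
    rw [← hn, WithBot.coe_le_coe]
    refine iSup₂_le fun rs hrs => ?_
    have h1 := ringKrullDim_add_length_eq_ringKrullDim_of_isRegular rs hrs.2
    have : Nontrivial (L ⧸ Ideal.ofList rs) := by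
      refine Ideal.Quotient.nontrivial_iff.2 fun htop => hrs.2.2 ?_
      simp [htop]
    have h2 : (0 : WithBot ℕ∞) ≤ ringKrullDim (L ⧸ Ideal.ofList rs) :=
      ringKrullDim_nonneg_of_nontrivial
    rw [← hn] at h1
    rw [← WithBot.coe_le_coe, ← h1]
    exact le_add_of_nonneg_left h2
  · obtain ⟨rs, hl, hm, hw⟩ := h
    refine hd.trans ?_
    have : (d : ℕ∞) ≤ localRingDepth L :=
      hl ▸ le_iSup₂ (f := fun (rs : List L) _ => (rs.length : ℕ∞)) rs
        ⟨hm, .of_isWeaklyRegular_of_mem_maximalIdeal L hm hw⟩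
    exact_mod_cast this

end CohenMacaulay

end

/-! ### Dimension, vertex covers and unmixedness. -/

section

open IsLocalRing

theorem height_le_height_comap_of_surjective {A B : Type*} [CommRing A] [CommRing B] (g : A →+* B)
    (hg : Function.Surjective g) (q : Ideal B) [q.IsPrime] : q.height ≤ (q.comap g).height := by
  have hmono : StrictMono (PrimeSpectrum.comap g) :=
    (Monotone.strictMono_of_injective (fun _ _ h => Ideal.comap_mono h)
      (PrimeSpectrum.comap_injective_of_surjective g hg))
  have := Order.height_le_height_apply_of_strictMono _ hmono ⟨q, ‹_›⟩
  rwa [← PrimeSpectrum.height_eq_orderHeight, ← PrimeSpectrum.height_eq_orderHeight] at this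

/-- The depth of a Noetherian local ring is at most the dimension of the quotient by any
minimal prime ideal; here for localizations, with the quotient taken before localizing. -/
theorem HasDepthGE.le_ringKrullDim_quotient {A : Type*} [CommRing A] [IsNoetherianRing A]
    {m : Ideal A} [m.IsPrime] {d : ℕ}
    (h : HasDepthGE (Localization.AtPrime m) (Localization.AtPrime m) d) {P : Ideal A}
    (hP : P ∈ minimalPrimes A) (hPm : P ≤ m) : (d : WithBot ℕ∞) ≤ ringKrullDim (A ⧸ P) := by
  obtain ⟨rs, rfl, hrs, hw⟩ := h
  have hnL : IsNoetherianRing (Localization.AtPrime m) :=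
    IsLocalization.isNoetherianRing m.primeCompl _ ‹_›
  have hPprime : P.IsPrime := hP.1.1
  -- Minimal primes are associated, and this survives localization, so the extension of `P`
  -- annihilates a nonzero element `u`.
  have hPass : P ∈ associatedPrimes A A := by
    refine Module.associatedPrimes.minimalPrimes_annihilator_subset_associatedPrimes A A ?_
    rwa [Module.annihilator_eq_bot.2 inferInstance]
  let P' : Ideal (Localization.AtPrime m) := P.map (algebraMap A (Localization.AtPrime m))
  have hdisj : Disjoint (m.primeCompl : Set A) P :=
    Set.disjoint_left.2 fun x hx hxP => hx (hPm hxP)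
  have hP'c : P'.under A = P :=
    IsLocalization.under_map_of_isPrime_disjoint m.primeCompl _ hPprime hdisj
  have hP'ass : P' ∈ associatedPrimes (Localization.AtPrime m) (Localization.AtPrime m) :=
    Module.associatedPrimes.mem_associatedPrimes_of_comap_mem_associatedPrimes_of_isLocalizedModule
      m.primeCompl (Algebra.linearMap A _) P'
      (by rwa [show P'.comap (algebraMap A (Localization.AtPrime m)) = P from hP'c])
  have hP'prime : P'.IsPrime := hP'ass.1
  obtain ⟨u, hu⟩ := (isAssociatedPrime_iff.1 hP'ass).2
  have hu0 : u ≠ 0 := by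
    rintro rfl
    exact hP'prime.ne_top (by simp [hu])
  refine (length_le_ringKrullDim_quotient hrs hw (P := P') hu0 fun r hr => ?_).trans ?_
  · rwa [hu, Submodule.mem_colon_singleton, Submodule.mem_bot] at hr
  let F : PrimeSpectrum.zeroLocus (R := Localization.AtPrime m) P' →
      PrimeSpectrum.zeroLocus (R := A) P :=
    fun q => ⟨PrimeSpectrum.comap (algebraMap A _) q.1, by
        change P ≤ q.1.asIdeal.comap _
        rw [← hP'c]
        exact Ideal.comap_mono q.2⟩
  have hF : StrictMono F :=
    Monotone.strictMono_of_injective (fun a b h => Ideal.comap_mono h) fun a b h =>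
      Subtype.ext (PrimeSpectrum.localization_comap_injective _ m.primeCompl
        (congrArg Subtype.val h))
  rw [ringKrullDim_quotient, ringKrullDim_quotient]
  exact Order.krullDim_le_of_strictMono F hF

/-- Induction on the variables: a maximal ideal of `C[X]` over a Jacobson ring contracts to a
maximal ideal, and its height is one more. -/
theorem MvPolynomial.height_eq_card_of_isMaximal {K : Type*} [Field K] {σ : Type*} [Finite σ]
    (m : Ideal (MvPolynomial σ K)) (hm : m.IsMaximal) : m.height = Nat.card σ := by
  induction σ using Finite.induction_empty_option with
  | of_equiv e ih =>
    let e' := (MvPolynomial.renameEquiv K e).toRingEquiv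
    have : (m.comap e').IsMaximal := Ideal.comap_isMaximal_of_equiv e'
    rw [← RingEquiv.height_comap e', ih _ this, Nat.card_congr e]
  | h_empty =>
    let e := (MvPolynomial.isEmptyAlgEquiv K PEmpty).symm.toRingEquiv
    have h : (m.comap e).IsMaximal := Ideal.comap_isMaximal_of_equiv e
    rw [← RingEquiv.height_comap e, (Ideal.eq_bot_or_top (m.comap e)).resolve_right h.ne_top]
    simp
  | h_option ih =>
    rename_i τ _
    let e := (MvPolynomial.optionEquivLeft K τ).symm.toRingEquiv
    have h : (m.comap e).IsMaximal := Ideal.comap_isMaximal_of_equiv e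
    let p := (m.comap e).comap (Polynomial.C : MvPolynomial τ K →+* _)
    have hp : p.IsMaximal := Polynomial.isMaximal_comap_C_of_isJacobsonRing (m.comap e)
    have hlies : (m.comap e).LiesOver p := ⟨rfl⟩
    rw [← RingEquiv.height_comap e, Polynomial.height_eq_height_add_one p (m.comap e), ih p hp,
      Finite.card_option, Nat.cast_add, Nat.cast_one]

section VariableIdeal

open MvPolynomial

variable {K : Type*} [Field K] {V : Type*}

open Classical in
/-- Setting the variables in `C` to zero. -/
noncomputable def evalZeroOn (K : Type*) [Field K] {V : Type*} (C : Set V) :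
    MvPolynomial V K →ₐ[K] MvPolynomial {v // v ∉ C} K :=
  aeval fun v => if h : v ∈ C then 0 else X ⟨v, h⟩

theorem evalZeroOn_X_of_mem {C : Set V} {v : V} (h : v ∈ C) : evalZeroOn K C (X v) = 0 := by
  simp [evalZeroOn, h]

theorem evalZeroOn_X_of_notMem {C : Set V} {v : V} (h : v ∉ C) :
    evalZeroOn K C (X v) = X ⟨v, h⟩ := by
  simp [evalZeroOn, h]

theorem evalZeroOn_rename (C : Set V) (f : MvPolynomial {v // v ∉ C} K) :
    evalZeroOn K C (rename Subtype.val f) = f := by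
  have : (evalZeroOn K C).comp (rename Subtype.val) = AlgHom.id K _ := by
    ext v
    simp [evalZeroOn_X_of_notMem v.2]
  exact DFunLike.congr_fun this f

theorem evalZeroOn_surjective (C : Set V) : Function.Surjective (evalZeroOn K C) :=
  fun f => ⟨_, evalZeroOn_rename C f⟩

theorem ker_evalZeroOn (C : Set V) :
    RingHom.ker (evalZeroOn K C) = Ideal.span (X '' C : Set (MvPolynomial V K)) := by
  apply le_antisymm
  · intro f hf
    have : ((Ideal.Quotient.mkₐ K (Ideal.span (X '' C : Set (MvPolynomial V K)))).comp
        (rename Subtype.val)).comp (evalZeroOn K C) = Ideal.Quotient.mkₐ K _ := by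
      ext v
      by_cases h : v ∈ C
      · simp only [AlgHom.comp_apply, evalZeroOn_X_of_mem h, map_zero, Ideal.Quotient.mkₐ_eq_mk]
        exact (Ideal.Quotient.eq_zero_iff_mem.2 (Ideal.subset_span (Set.mem_image_of_mem X h))).symm
      · simp [evalZeroOn_X_of_notMem h]
    have := DFunLike.congr_fun this f
    rw [RingHom.mem_ker] at hf
    rw [AlgHom.comp_apply, hf, map_zero] at this
    exact Ideal.Quotient.eq_zero_iff_mem.1 this.symm
  · rw [Ideal.span_le]
    rintro _ ⟨v, hv, rfl⟩
    exact evalZeroOn_X_of_mem hv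

theorem isPrime_span_X_image (C : Set V) :
    (Ideal.span (X '' C : Set (MvPolynomial V K))).IsPrime := by
  rw [← ker_evalZeroOn]
  exact RingHom.ker_isPrime _

theorem ringKrullDim_quotient_span_X_image [Finite V] (C : Set V) :
    ringKrullDim (MvPolynomial V K ⧸ Ideal.span (X '' C : Set (MvPolynomial V K))) =
      Nat.card {v // v ∉ C} := by
  rw [← ker_evalZeroOn]
  refine (ringKrullDim_eq_of_ringEquiv
    (Ideal.quotientKerAlgEquivOfSurjective (evalZeroOn_surjective C)).toRingEquiv).trans ?_
  simp

end VariableIdeal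

namespace WeightedOrientedGraph

open MvPolynomial

variable {K : Type*} [Field K] {V : Type*} {D : WeightedOrientedGraph V}

theorem edgeIdeal_le_span_X_image {C : Set V} (hC : D.underlying.IsVertexCover C) :
    D.edgeIdeal K ≤ Ideal.span (X '' C) := by
  refine Ideal.span_le.2 ?_
  rintro _ ⟨u, v, h, rfl⟩
  rcases hC (Or.inl h : D.underlying.Adj u v) with hu | hv
  · exact Ideal.mul_mem_right _ _ (Ideal.subset_span (Set.mem_image_of_mem X hu))
  · exact Ideal.mul_mem_left _ _ (Ideal.pow_mem_of_mem _ (Ideal.subset_span (Set.mem_image_of_mem X hv)) _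
      (D.weight_pos v))

theorem isVertexCover_setOf_X_mem {Q : Ideal (MvPolynomial V K)} [Q.IsPrime]
    (hQ : D.edgeIdeal K ≤ Q) : D.underlying.IsVertexCover {v | (X v : MvPolynomial V K) ∈ Q} := by
  have key : ∀ u v, D.Adj u v → (X u : MvPolynomial V K) ∈ Q ∨ (X v : MvPolynomial V K) ∈ Q :=
    fun u v h => ((Ideal.IsPrime.mem_or_mem ‹_› (hQ (Ideal.subset_span ⟨u, v, h, rfl⟩))).imp_right
      fun h => Ideal.IsPrime.mem_of_pow_mem ‹_› _ h)
  rintro u v (h | h)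
  · exact key u v h
  · exact (key v u h).symm

/-- The variables in the smallest prime of a chain form a vertex cover `C`, so the whole chain lives
over the ideal generated by `C`, whose quotient is a polynomial ring in the remaining variables. -/
theorem ringKrullDim_quotient_edgeIdeal_le [Finite V] {d : ℕ}
    (h : ∀ C : Set V, D.underlying.IsVertexCover C → Nat.card {v // v ∉ C} ≤ d) :
    ringKrullDim (MvPolynomial V K ⧸ D.edgeIdeal K) ≤ d := by
  rw [ringKrullDim_quotient]
  refine iSup_le fun p => ?_
  have hp : D.edgeIdeal K ≤ p.head.1.asIdeal := p.head.2
  let C : Set V := {v | (X v : MvPolynomial V K) ∈ p.head.1.asIdeal}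
  have hC : D.underlying.IsVertexCover C := isVertexCover_setOf_X_mem hp
  have hle : Ideal.span (X '' C) ≤ p.head.1.asIdeal := by
    rw [Ideal.span_le]
    rintro _ ⟨v, hv, rfl⟩
    exact hv
  let q : LTSeries (PrimeSpectrum.zeroLocus
      (R := MvPolynomial V K) (Ideal.span (X '' C : Set (MvPolynomial V K)))) :=
    { length := p.length
      toFun := fun i => ⟨(p i).1, hle.trans (p.head_le i)⟩
      step := fun i => p.step i }
  have h1 : (p.length : WithBot ℕ∞) ≤ ringKrullDim
      (MvPolynomial V K ⧸ Ideal.span (X '' C : Set (MvPolynomial V K))) := by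
    rw [ringKrullDim_quotient]
    exact le_iSup (fun q : LTSeries _ => (q.length : WithBot ℕ∞)) q
  rw [ringKrullDim_quotient_span_X_image] at h1
  exact h1.trans (by exact_mod_cast h C hC)

/-- The preimage of `p` in `K[V]` has height `|V|`, and killing the variables of `C` lowers it by at
most `|C|`. -/
theorem card_le_height_of_isMaximal [Finite V] {C : Set V} (hC : D.underlying.IsVertexCover C)
    (p : Ideal (MvPolynomial V K ⧸ D.edgeIdeal K)) [p.IsMaximal]
    (hp : ∀ v ∈ C, Ideal.Quotient.mk _ (X v) ∈ p) :
    (Nat.card {v // v ∉ C} : ℕ∞) ≤ p.height := by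
  let m := p.comap (Ideal.Quotient.mk (D.edgeIdeal K))
  have hm : m.IsMaximal := Ideal.comap_isMaximal_of_surjective _ Ideal.Quotient.mk_surjective
  let P : Ideal (MvPolynomial V K) := Ideal.span (X '' C)
  have hPm : (X '' C : Set (MvPolynomial V K)) ⊆ m := by
    rintro _ ⟨v, hv, rfl⟩
    exact hp v hv
  have hPm' : P ≤ m := Ideal.span_le.2 hPm
  have h1 := Ideal.height_le_height_add_encard_of_subset _ hPm
  rw [height_eq_card_of_isMaximal m hm] at h1
  have h2 : (X '' C : Set (MvPolynomial V K)).encard ≤ C.ncard := by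
    rw [(Set.toFinite C).cast_ncard_eq]
    exact Set.encard_image_le _ _
  have hprime : (m.map (Ideal.Quotient.mk P)).IsPrime :=
    Ideal.isPrime_map_quotientMk_of_isPrime hPm'
  let g := Ideal.Quotient.factor (edgeIdeal_le_span_X_image (K := K) hC)
  have h3 := height_le_height_comap_of_surjective g (Ideal.Quotient.factor_surjective _)
    (m.map (Ideal.Quotient.mk P))
  have h4 : (m.map (Ideal.Quotient.mk P)).comap g = p := by
    ext x
    obtain ⟨x, rfl⟩ := Ideal.Quotient.mk_surjective x
    have : x ∈ (m.map (Ideal.Quotient.mk P)).comap (Ideal.Quotient.mk P) ↔ x ∈ m := by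
      rw [Ideal.comap_map_of_surjective _ Ideal.Quotient.mk_surjective,
        sup_eq_left.2 (by rwa [← RingHom.ker_eq_comap_bot, Ideal.mk_ker])]
    exact this
  rw [h4] at h3
  have hcard : Nat.card V = Nat.card {v // v ∉ C} + C.ncard := by
    rw [← Set.ncard_add_ncard_compl C, add_comm]
    rfl
  rw [hcard, Nat.cast_add] at h1
  have h5 : (Nat.card {v // v ∉ C} : ℕ∞) + C.ncard ≤ p.height + C.ncard :=
    h1.trans (add_le_add h3 h2)
  exact (ENat.add_le_add_iff_right (ENat.natCast_ne_top _)).1 h5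

/-- Over a field, the minimal vertex covers of a Cohen–Macaulay weighted oriented graph have
the smallest cardinality among all vertex covers. -/
theorem IsCohenMacaulay.card_compl_le [Finite V] (hD : D.IsCohenMacaulay K) {C C' : Set V}
    (hC : Minimal D.underlying.IsVertexCover C) (hC' : D.underlying.IsVertexCover C') :
    Nat.card {v // v ∉ C'} ≤ Nat.card {v // v ∉ C} := by
  have hI : ∀ f ∈ D.edgeIdeal K, (constantCoeff : MvPolynomial V K →+* K) f = 0 := by
    have : D.edgeIdeal K ≤ RingHom.ker (constantCoeff : MvPolynomial V K →+* K) := by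
      refine Ideal.span_le.2 ?_
      rintro _ ⟨u, v, -, rfl⟩
      simp [RingHom.mem_ker]
    exact this
  -- Localizing at the origin makes every variable lie in the maximal ideal, so both covers are
  -- visible there.
  let c := Ideal.Quotient.lift (D.edgeIdeal K) constantCoeff hI
  have hc : Function.Surjective c := Ideal.Quotient.lift_surjective_of_surjective _ _
    (fun a => ⟨MvPolynomial.C a, constantCoeff_C _ _⟩)
  let m : Ideal (MvPolynomial V K ⧸ D.edgeIdeal K) := RingHom.ker c
  have hm : m.IsMaximal := RingHom.ker_isMaximal_of_surjective c hc
  have hX : ∀ v, Ideal.Quotient.mk (D.edgeIdeal K) (X v) ∈ m := fun v => by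
    simp [m, c, RingHom.mem_ker]
  let L := Localization.AtPrime m
  have hdim : (Nat.card {v // v ∉ C'} : WithBot ℕ∞) ≤ ringKrullDim L := by
    rw [IsLocalization.AtPrime.ringKrullDim_eq_height m L]
    exact_mod_cast card_le_height_of_isMaximal hC' m fun v _ => hX v
  have hdepth := (hD.localization m).hasDepthGE hdim
  have hnA := hD.isNoetherianRing
  let P₀ : Ideal (MvPolynomial V K) := Ideal.span (X '' C)
  have hP₀ : P₀.IsPrime := isPrime_span_X_image C
  have hIP : D.edgeIdeal K ≤ P₀ := edgeIdeal_le_span_X_image hC.1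
  -- The variables of a prime between `I(D)` and `P₀` form a cover inside `C`, which is all of `C`
  -- by minimality.
  have hmin : P₀ ∈ (D.edgeIdeal K).minimalPrimes := by
    refine ⟨⟨hP₀, hIP⟩, fun Q hQ hQP => ?_⟩
    have := hQ.1
    have hsub : {v | (X v : MvPolynomial V K) ∈ Q} ⊆ C := fun v hv => by
      have := mem_ideal_span_X_image.1 (hQP hv) (Finsupp.single v 1) (by simp)
      obtain ⟨i, hi, hne⟩ := this
      rw [Finsupp.single_apply_ne_zero] at hne
      exact hne.1 ▸ hi
    have := hC.2 (isVertexCover_setOf_X_mem hQ.2) hsub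
    rw [Ideal.span_le]
    rintro _ ⟨v, hv, rfl⟩
    exact this hv
  let P := P₀.map (Ideal.Quotient.mk (D.edgeIdeal K))
  have hPc : P.comap (Ideal.Quotient.mk (D.edgeIdeal K)) = P₀ := by
    rw [Ideal.comap_map_of_surjective _ Ideal.Quotient.mk_surjective,
        sup_eq_left.2 (by rwa [← RingHom.ker_eq_comap_bot, Ideal.mk_ker])]
  have hPprime : P.IsPrime := Ideal.isPrime_map_quotientMk_of_isPrime hIP
  have hPm : P ≤ m := by
    rw [Ideal.map_le_iff_le_comap, Ideal.span_le]
    rintro _ ⟨v, -, rfl⟩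
    exact hX v
  have hPmin : P ∈ minimalPrimes (MvPolynomial V K ⧸ D.edgeIdeal K) := by
    refine ⟨⟨hPprime, bot_le⟩, fun Q hQ hQP => ?_⟩
    have := hQ.1
    rw [Ideal.map_le_iff_le_comap]
    refine hmin.2 ⟨Ideal.comap_isPrime _ Q, ?_⟩ ((Ideal.comap_mono hQP).trans hPc.le)
    intro x hx
    rw [Ideal.mem_comap, Ideal.Quotient.eq_zero_iff_mem.2 hx]
    exact Q.zero_mem
  have hdimP : ringKrullDim ((MvPolynomial V K ⧸ D.edgeIdeal K) ⧸ P) ≤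
      ringKrullDim (MvPolynomial V K ⧸ P₀) :=
    ringKrullDim_le_of_surjective
      (Ideal.quotientMap P (Ideal.Quotient.mk (D.edgeIdeal K)) Ideal.le_comap_map)
      (Ideal.quotientMap_surjective Ideal.Quotient.mk_surjective)
  have := (hdepth.le_ringKrullDim_quotient hPmin hPm).trans
    (hdimP.trans (ringKrullDim_quotient_span_X_image C).le)
  exact_mod_cast this

/-- The localizations of a Cohen–Macaulay graph ring at its maximal ideals have depth at least
the number of vertices outside any vertex cover. -/
theorem IsCohenMacaulay.hasDepthGE [Finite V] (hD : D.IsCohenMacaulay K) {C : Set V}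
    (hC : D.underlying.IsVertexCover C)
    (p : Ideal (MvPolynomial V K ⧸ D.edgeIdeal K)) [p.IsMaximal] :
    HasDepthGE (Localization.AtPrime p) (Localization.AtPrime p) (Nat.card {v // v ∉ C}) := by
  refine (hD.localization p).hasDepthGE ?_
  rw [IsLocalization.AtPrime.ringKrullDim_eq_height p]
  have hle : D.edgeIdeal K ≤ p.comap (Ideal.Quotient.mk (D.edgeIdeal K)) := fun x hx => by
    rw [Ideal.mem_comap, Ideal.Quotient.eq_zero_iff_mem.2 hx]
    exact p.zero_mem
  -- A minimal cover `B` among the variables vanishing at `p` bounds the height from below;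
  -- unmixedness then compares `B` with `C`.
  obtain ⟨B, hB, hBmin⟩ := exists_minimal_le_of_wellFoundedLT D.underlying.IsVertexCover _
    (isVertexCover_setOf_X_mem hle)
  have h1 := card_le_height_of_isMaximal (K := K) hBmin.1 p fun v hv => hB hv
  have h2 := hD.card_compl_le hBmin hC
  exact_mod_cast (Nat.cast_le.2 h2).trans h1

end WeightedOrientedGraph

end

/-! ### Monomial ideals and the graph rings of vertex deletions. -/

section

universe u

section MonomialIdeal

open MvPolynomial

variable {K : Type*} [Field K] {V : Type*}

/-- The ideal generated by the monomials with exponents in `E`. -/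
noncomputable def monomialIdeal (K : Type*) [Field K] {V : Type*} (E : Set (V →₀ ℕ)) :
    Ideal (MvPolynomial V K) :=
  Ideal.span ((fun s => monomial s (1 : K)) '' E)

theorem mem_monomialIdeal {E : Set (V →₀ ℕ)} {f : MvPolynomial V K} :
    f ∈ monomialIdeal K E ↔ ∀ m ∈ f.support, ∃ e ∈ E, e ≤ m :=
  mem_ideal_span_monomial_image

theorem monomial_mem_monomialIdeal {E : Set (V →₀ ℕ)} {e : V →₀ ℕ} (he : e ∈ E) :
    monomial e (1 : K) ∈ monomialIdeal K E :=
  Ideal.subset_span ⟨e, he, rfl⟩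

theorem mul_monomial_mem_monomialIdeal_iff {E E' : Set (V →₀ ℕ)} {a : V →₀ ℕ}
    (h : ∀ m, (∃ e ∈ E, e ≤ m + a) ↔ ∃ e ∈ E', e ≤ m) (f : MvPolynomial V K) :
    f * monomial a 1 ∈ monomialIdeal K E ↔ f ∈ monomialIdeal K E' := by
  rw [mem_monomialIdeal, mem_monomialIdeal]
  constructor
  · intro hf m hm
    refine (h m).1 (hf _ ?_)
    rw [mem_support_iff, coeff_mul_monomial, mul_one]
    exact mem_support_iff.1 hm
  · intro hf m hm
    rw [mem_support_iff, coeff_mul_monomial', mul_one] at hm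
    obtain ⟨hle, hne⟩ := ite_ne_right_iff.1 hm
    have := (h (m - a)).2 (hf _ (mem_support_iff.2 hne))
    rwa [tsub_add_cancel_of_le hle] at this

theorem monomialIdeal_sup_span {E E' : Set (V →₀ ℕ)} {a : V →₀ ℕ}
    (h : ∀ m, ((∃ e ∈ E, e ≤ m) ∨ a ≤ m) ↔ ∃ e ∈ E', e ≤ m) :
    monomialIdeal K E ⊔ Ideal.span {monomial a 1} = monomialIdeal K E' := by
  have : monomialIdeal K E ⊔ Ideal.span {monomial a 1} = monomialIdeal K (E ∪ {a}) := by
    rw [monomialIdeal, monomialIdeal, ← Ideal.span_union, Set.image_union, Set.image_singleton]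
  rw [this]
  ext f
  rw [mem_monomialIdeal, mem_monomialIdeal]
  refine forall₂_congr fun m _ => (Iff.trans ?_ (h m))
  simp [or_and_right, exists_or, or_comm]

/-- Colons by a monomial commute with localization, so the depth lemma only needs the two
combinatorial conditions on exponents: `E₁` describes the colon and `E₂` the sum. -/
theorem HasDepthGE.monomialIdeal_of_colon [Finite V] (m : Ideal (MvPolynomial V K)) [m.IsPrime]
    {E E₁ E₂ : Set (V →₀ ℕ)} {a : V →₀ ℕ} {d : ℕ}
    (h₁ : ∀ m, (∃ e ∈ E, e ≤ m + a) ↔ ∃ e ∈ E₁, e ≤ m)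
    (h₂ : ∀ m, ((∃ e ∈ E, e ≤ m) ∨ a ≤ m) ↔ ∃ e ∈ E₂, e ≤ m)
    (hd₁ : HasDepthGE (Localization.AtPrime m) (Localization.AtPrime m ⧸
      (monomialIdeal K E₁).map (algebraMap _ (Localization.AtPrime m))) d)
    (hd₂ : HasDepthGE (Localization.AtPrime m) (Localization.AtPrime m ⧸
      (monomialIdeal K E₂).map (algebraMap _ (Localization.AtPrime m))) d) :
    HasDepthGE (Localization.AtPrime m) (Localization.AtPrime m ⧸
      (monomialIdeal K E).map (algebraMap _ (Localization.AtPrime m))) d := by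
  have : IsNoetherianRing (Localization.AtPrime m) :=
    IsLocalization.isNoetherianRing m.primeCompl _ inferInstance
  refine HasDepthGE.quotient_of_colon (g := algebraMap _ _ (monomial a (1 : K))) ?_ hd₁ ?_
  · intro x
    obtain ⟨f, s, rfl⟩ := IsLocalization.exists_mk'_eq m.primeCompl x
    rw [mul_comm, IsLocalization.mul_mk'_eq_mk'_of_mul, IsLocalization.mk'_mem_map_algebraMap_iff,
      IsLocalization.mk'_mem_map_algebraMap_iff]
    refine exists_congr fun t => and_congr_right fun _ => ?_
    rw [← mul_monomial_mem_monomialIdeal_iff h₁, mul_comm _ f, mul_assoc]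
  · rwa [← monomialIdeal_sup_span h₂, Ideal.map_sup, Ideal.map_span, Set.image_singleton] at hd₂

end MonomialIdeal

theorem hasDepthGE_localization_quotient_of_ker_polynomial {R C : Type u} [CommRing R]
    [CommRing C] [IsJacobsonRing C] (φ : R →+* Polynomial C) (hφ : Function.Surjective φ)
    {J : Ideal R} (hJ : RingHom.ker φ = J) {d : ℕ}
    (h : ∀ (p : Ideal C) [p.IsMaximal],
      HasDepthGE (Localization.AtPrime p) (Localization.AtPrime p) d)
    (m : Ideal R) [m.IsMaximal] :
    HasDepthGE (Localization.AtPrime m)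
      (Localization.AtPrime m ⧸ J.map (algebraMap R (Localization.AtPrime m))) (d + 1) := by
  subst hJ
  exact hasDepthGE_localization_quotient_ker φ hφ (fun n _ => hasDepthGE_polynomial h n) m

namespace WeightedOrientedGraph

open MvPolynomial

variable {K : Type*} [Field K] {V : Type*} (D : WeightedOrientedGraph V)

/-- The exponents of the generators of the edge ideal. -/
def edgeExponents : Set (V →₀ ℕ) :=
  {e | ∃ u v, D.Adj u v ∧ e = Finsupp.single u 1 + Finsupp.single v (D.weight v)}

/-- The exponents of the edges outside `T` and of the variables in `T` other than `t`. -/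
def deletionExponents (T : Set V) (t : V) : Set (V →₀ ℕ) :=
  {e | ∃ u v, D.Adj u v ∧ u ∉ T ∧ v ∉ T ∧
    e = Finsupp.single u 1 + Finsupp.single v (D.weight v)} ∪
  {e | ∃ u ∈ T, u ≠ t ∧ e = Finsupp.single u 1}

theorem monomial_single_add_single (u v : V) (k : ℕ) :
    monomial (Finsupp.single u 1 + Finsupp.single v k) (1 : K) = X u * X v ^ k := by
  rw [X_pow_eq_monomial, X, monomial_mul, one_mul]

theorem edgeIdeal_eq_monomialIdeal : D.edgeIdeal K = monomialIdeal K D.edgeExponents := by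
  rw [edgeIdeal, monomialIdeal]
  congr 1
  ext f
  constructor
  · rintro ⟨u, v, h, rfl⟩
    exact ⟨_, ⟨u, v, h, rfl⟩, monomial_single_add_single u v _⟩
  · rintro ⟨_, ⟨u, v, h, rfl⟩, rfl⟩
    exact ⟨u, v, h, monomial_single_add_single u v _⟩

open Classical in
/-- The homomorphism from `K[V]` to the polynomial ring over the graph ring of `D ∖ T` that sends
`t ∈ T` to the polynomial variable and the other elements of `T` to zero. -/
noncomputable def deletionHom (K : Type*) [Field K] {V : Type*} (D : WeightedOrientedGraph V)
    (T : Set V) (t : V) : MvPolynomial V K →ₐ[K]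
      Polynomial (MvPolynomial {v // v ∉ T} K ⧸ (D.deleteVerts T).edgeIdeal K) :=
  aeval (S₁ := Polynomial (MvPolynomial {v // v ∉ T} K ⧸ (D.deleteVerts T).edgeIdeal K))
    fun v => if h : v ∈ T then if v = t then Polynomial.X else 0
      else Polynomial.C (Ideal.Quotient.mk _ (X ⟨v, h⟩))

variable {D} {T : Set V} {t : V}

theorem deletionHom_X_self (ht : t ∈ T) : deletionHom K D T t (X t) = Polynomial.X := by
  simp [deletionHom, ht]

theorem deletionHom_X_of_mem {v : V} (hv : v ∈ T) (hvt : v ≠ t) :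
    deletionHom K D T t (X v) = 0 := by
  simp [deletionHom, hv, hvt]

theorem deletionHom_X_of_notMem {v : V} (hv : v ∉ T) :
    deletionHom K D T t (X v) = Polynomial.C (Ideal.Quotient.mk _ (X ⟨v, hv⟩)) := by
  simp [deletionHom, hv]

theorem deletionHom_rename (f : MvPolynomial {v // v ∉ T} K) :
    deletionHom K D T t (rename Subtype.val f) = Polynomial.C (Ideal.Quotient.mk _ f) := by
  have : ((deletionHom K D T t).comp (rename Subtype.val)) =
      (Polynomial.CAlgHom (R := K)).comp
        (Ideal.Quotient.mkₐ K ((D.deleteVerts T).edgeIdeal K)) := by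
    ext v
    simp [deletionHom_X_of_notMem v.2]
  exact DFunLike.congr_fun this f

theorem deletionHom_surjective (ht : t ∈ T) : Function.Surjective (deletionHom K D T t) := by
  intro p
  induction p using Polynomial.induction_on' with
  | add p q hp hq =>
    obtain ⟨a, rfl⟩ := hp
    obtain ⟨b, rfl⟩ := hq
    exact ⟨a + b, map_add _ _ _⟩
  | monomial n c =>
    obtain ⟨f, rfl⟩ := Ideal.Quotient.mk_surjective c
    refine ⟨rename Subtype.val f * X t ^ n, ?_⟩
    rw [map_mul, map_pow, deletionHom_rename, deletionHom_X_self ht,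
      Polynomial.C_mul_X_pow_eq_monomial]

theorem monomialIdeal_le_ker_deletionHom :
    monomialIdeal K (D.deletionExponents T t) ≤ RingHom.ker (deletionHom K D T t) := by
  refine Ideal.span_le.2 ?_
  rintro _ ⟨_, ⟨u, v, h, hu, hv, rfl⟩ | ⟨u, hu, hut, rfl⟩, rfl⟩
  · simp only [SetLike.mem_coe, RingHom.mem_ker]
    rw [monomial_single_add_single, map_mul, map_pow, deletionHom_X_of_notMem hu,
      deletionHom_X_of_notMem hv, ← map_pow, ← map_pow, ← map_mul, ← map_mul,
      Ideal.Quotient.eq_zero_iff_mem.2, map_zero]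
    exact Ideal.subset_span ⟨⟨u, hu⟩, ⟨v, hv⟩, h, rfl⟩
  · exact deletionHom_X_of_mem hu hut

theorem edgeIdeal_deleteVerts_le_ker (t : V) : (D.deleteVerts T).edgeIdeal K ≤
    RingHom.ker ((Ideal.Quotient.mk (monomialIdeal K (D.deletionExponents T t))).comp
      (rename (R := K) (Subtype.val : {v // v ∉ T} → V)).toRingHom) := by
  refine Ideal.span_le.2 ?_
  rintro _ ⟨u, v, h, rfl⟩
  refine Ideal.Quotient.eq_zero_iff_mem.2 ?_
  have : X u.1 * X v.1 ^ D.weight v ∈ monomialIdeal K (D.deletionExponents T t) := by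
    rw [← monomial_single_add_single]
    exact monomial_mem_monomialIdeal (Or.inl ⟨u, v, h, u.2, v.2, rfl⟩)
  simpa [deleteVerts] using this

/-- The inverse of `deletionHom` modulo its kernel. -/
noncomputable def deletionInverse (K : Type*) [Field K] {V : Type*} (D : WeightedOrientedGraph V)
    (T : Set V) (t : V) :
    Polynomial (MvPolynomial {v // v ∉ T} K ⧸ (D.deleteVerts T).edgeIdeal K) →+*
      MvPolynomial V K ⧸ monomialIdeal K (D.deletionExponents T t) :=
  Polynomial.eval₂RingHom (Ideal.Quotient.lift _ ((Ideal.Quotient.mk _).comp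
    (rename (R := K) (Subtype.val : {v // v ∉ T} → V)).toRingHom)
      fun _ hf => RingHom.mem_ker.1 (edgeIdeal_deleteVerts_le_ker t hf)) (Ideal.Quotient.mk _ (X t))

theorem deletionInverse_C (f : MvPolynomial {v // v ∉ T} K) :
    deletionInverse K D T t (Polynomial.C (Ideal.Quotient.mk _ f)) =
      Ideal.Quotient.mk _ (rename Subtype.val f) :=
  Polynomial.eval₂_C _ _

theorem deletionInverse_X :
    deletionInverse K D T t Polynomial.X = Ideal.Quotient.mk _ (X t) :=
  Polynomial.eval₂_X _ _

theorem deletionInverse_comp (ht : t ∈ T) :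
    (deletionInverse K D T t).comp (deletionHom K D T t).toRingHom = Ideal.Quotient.mk _ := by
  refine MvPolynomial.ringHom_ext (fun r => ?_) fun v => ?_
  · have : deletionHom K D T t (C r) = Polynomial.C (Ideal.Quotient.mk _ (C r)) :=
      (deletionHom K D T t).commutes r
    refine (congrArg (deletionInverse K D T t) this).trans ?_
    rw [deletionInverse_C, rename_C]
  · change deletionInverse K D T t (deletionHom K D T t (X v)) = _
    by_cases hv : v ∈ T
    · by_cases hvt : v = t
      · rw [hvt, deletionHom_X_self ht, deletionInverse_X]
      · rw [deletionHom_X_of_mem hv hvt, map_zero]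
        exact (Ideal.Quotient.eq_zero_iff_mem.2
          (monomial_mem_monomialIdeal (Or.inr ⟨v, hv, hvt, rfl⟩))).symm
    · rw [deletionHom_X_of_notMem hv, deletionInverse_C, rename_X]

/-- Composing with `deletionInverse` gives the quotient map, so nothing outside the monomial ideal
is killed. -/
theorem ker_deletionHom (ht : t ∈ T) :
    RingHom.ker (deletionHom K D T t) = monomialIdeal K (D.deletionExponents T t) := by
  refine le_antisymm (fun f hf => ?_) monomialIdeal_le_ker_deletionHom
  have h := DFunLike.congr_fun (deletionInverse_comp (K := K) (D := D) ht) f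
  rw [← Ideal.Quotient.eq_zero_iff_mem, ← h]
  exact (congrArg (deletionInverse K D T t) (RingHom.mem_ker.1 hf)).trans (map_zero _)

/-- If the graph ring of `D ∖ T` has depth at least `d` at all maximal ideals, then adding the
variable `t` raises the depth by one. -/
theorem hasDepthGE_monomialIdeal_deletionExponents [Finite V] (ht : t ∈ T) {d : ℕ}
    (h : ∀ (p : Ideal (MvPolynomial {v // v ∉ T} K ⧸ (D.deleteVerts T).edgeIdeal K))
      [p.IsMaximal], HasDepthGE (Localization.AtPrime p) (Localization.AtPrime p) d)
    (m : Ideal (MvPolynomial V K)) [m.IsMaximal] :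
    HasDepthGE (Localization.AtPrime m) (Localization.AtPrime m ⧸
      (monomialIdeal K (D.deletionExponents T t)).map
        (algebraMap _ (Localization.AtPrime m))) (d + 1) := by
  have : IsJacobsonRing (MvPolynomial {v // v ∉ T} K ⧸ (D.deleteVerts T).edgeIdeal K) :=
    isJacobsonRing_of_surjective ⟨_, Ideal.Quotient.mk_surjective⟩
  exact hasDepthGE_localization_quotient_of_ker_polynomial (deletionHom K D T t).toRingHom
    (deletionHom_surjective ht) (ker_deletionHom ht) h m

end WeightedOrientedGraph

end

/-! ### Colons and sums with powers of the sink variable. -/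

namespace WeightedOrientedGraph

open MvPolynomial

variable {V : Type*} {D : WeightedOrientedGraph V}

theorem single_add_single_le_iff {u v : V} (huv : u ≠ v) {k : ℕ} {m : V →₀ ℕ} :
    Finsupp.single u 1 + Finsupp.single v k ≤ m ↔ 1 ≤ m u ∧ k ≤ m v := by
  classical
  constructor
  · intro h
    have hu := h u
    have hv := h v
    simp [huv, huv.symm] at hu hv
    exact ⟨by omega, hv⟩
  · rintro ⟨hu, hv⟩ x
    rcases eq_or_ne x u with rfl | hx
    · simpa [huv.symm] using hu
    · rcases eq_or_ne x v with rfl | hx'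
      · simpa [huv] using hv
      · simp [Finsupp.single_eq_of_ne hx, Finsupp.single_eq_of_ne hx']

theorem Adj_ne {u v : V} (h : D.Adj u v) : u ≠ v := by
  rintro rfl
  exact D.asymm _ _ h h

theorem exists_edgeExponents_le_iff {m : V →₀ ℕ} :
    (∃ e ∈ D.edgeExponents, e ≤ m) ↔ ∃ u v, D.Adj u v ∧ 1 ≤ m u ∧ D.weight v ≤ m v := by
  constructor
  · rintro ⟨_, ⟨u, v, h, rfl⟩, hle⟩
    exact ⟨u, v, h, (single_add_single_le_iff (Adj_ne h)).1 hle⟩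
  · rintro ⟨u, v, h, hle⟩
    exact ⟨_, ⟨u, v, h, rfl⟩, (single_add_single_le_iff (Adj_ne h)).2 hle⟩

theorem exists_deletionExponents_le_iff {T : Set V} {t : V} {m : V →₀ ℕ} :
    (∃ e ∈ D.deletionExponents T t, e ≤ m) ↔
      (∃ u v, D.Adj u v ∧ u ∉ T ∧ v ∉ T ∧ 1 ≤ m u ∧ D.weight v ≤ m v) ∨
        ∃ u ∈ T, u ≠ t ∧ 1 ≤ m u := by
  constructor
  · rintro ⟨_, ⟨u, v, h, hu, hv, rfl⟩ | ⟨u, hu, hut, rfl⟩, hle⟩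
    · exact Or.inl ⟨u, v, h, hu, hv, (single_add_single_le_iff (Adj_ne h)).1 hle⟩
    · exact Or.inr ⟨u, hu, hut, Finsupp.single_le_iff.1 hle⟩
  · rintro (⟨u, v, h, hu, hv, hle⟩ | ⟨u, hu, hut, hle⟩)
    · exact ⟨_, Or.inl ⟨u, v, h, hu, hv, rfl⟩, (single_add_single_le_iff (Adj_ne h)).2 hle⟩
    · exact ⟨_, Or.inr ⟨u, hu, hut, rfl⟩, Finsupp.single_le_iff.2 hle⟩

section Whisker

variable {z y : V} {X : Set V}

/-- The exponents of the edges together with that of the `i`-th power of the variable `z`. -/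
def truncatedExponents (D : WeightedOrientedGraph V) (z : V) (i : ℕ) : Set (V →₀ ℕ) :=
  D.edgeExponents ∪ {Finsupp.single z i}

theorem exists_truncatedExponents_le_iff {i : ℕ} {m : V →₀ ℕ} :
    (∃ e ∈ D.truncatedExponents z i, e ≤ m) ↔
      (∃ u v, D.Adj u v ∧ 1 ≤ m u ∧ D.weight v ≤ m v) ∨ i ≤ m z := by
  rw [← exists_edgeExponents_le_iff]
  simp [truncatedExponents, or_and_right, exists_or, Finsupp.single_le_iff, or_comm]

/-- The vertex `z` has only incoming edges, which come from `X` and from the leaf `y`. -/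
structure IsWhiskeredSink (D : WeightedOrientedGraph V) (z y : V) (X : Set V) : Prop where
  mem_of_adj : ∀ u, D.underlying.Adj z u → u ∈ insert y X
  eq_of_adj : ∀ u, D.underlying.Adj y u → u = z
  adj : ∀ x ∈ insert y X, D.Adj x z

/-- Every edge is either disjoint from `{z, y}` or points to `z`. -/
theorem IsWhiskeredSink.adj_iff (hD : D.IsWhiskeredSink z y X) {u v : V} :
    D.Adj u v ↔ (D.Adj u v ∧ u ∉ ({z, y} : Set V) ∧ v ∉ ({z, y} : Set V)) ∨
      (u ∈ insert y X ∧ v = z) := by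
  constructor
  · intro h
    have huz : u ≠ z := by
      rintro rfl
      exact D.asymm _ _ h (hD.adj v (hD.mem_of_adj v (Or.inl h)))
    by_cases hvz : v = z
    · exact Or.inr ⟨hD.mem_of_adj u (Or.inr (hvz ▸ h)), hvz⟩
    · have huy : u ≠ y := by
        rintro rfl
        exact hvz (hD.eq_of_adj v (Or.inl h))
      have hvy : v ≠ y := by
        rintro rfl
        exact huz (hD.eq_of_adj u (Or.inr h))
      exact Or.inl ⟨h, by simp [huz, huy], by simp [hvz, hvy]⟩
  · rintro (h | ⟨hu, rfl⟩)
    · exact h.1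
    · exact hD.adj u hu

/-- Modulo `z` all edges at `z` disappear, leaving `D_G` and the free variable `y`. -/
theorem exists_truncatedExponents_one_le_iff (hD : D.IsWhiskeredSink z y X) (m : V →₀ ℕ) :
    (∃ e ∈ D.truncatedExponents z 1, e ≤ m) ↔ ∃ e ∈ D.deletionExponents {z, y} y, e ≤ m := by
  have hzy : z ≠ y := (Adj_ne (hD.adj y (Set.mem_insert _ _))).symm
  rw [exists_truncatedExponents_le_iff, exists_deletionExponents_le_iff]
  constructor
  · rintro (⟨u, v, h, hu, hv⟩ | h)
    · rcases hD.adj_iff.1 h with h' | ⟨-, rfl⟩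
      · exact Or.inl ⟨u, v, h, h'.2.1, h'.2.2, hu, hv⟩
      · exact Or.inr ⟨v, by simp, hzy, (D.weight_pos v).trans_le hv⟩
    · exact Or.inr ⟨z, by simp, hzy, h⟩
  · rintro (⟨u, v, h, -, -, hu, hv⟩ | ⟨u, hu, huy, h⟩)
    · exact Or.inl ⟨u, v, h, hu, hv⟩
    · obtain rfl : u = z := by simpa [huy] using hu
      exact Or.inr h

/-- Dividing a generator `u z^w` by `z` leaves `u z^(w-1)`, which `z^i` absorbs because `i + 1 ≤ w`.
For `i = 0` both sides always hold. -/
theorem exists_truncatedExponents_succ_le_add_iff (hD : D.IsWhiskeredSink z y X) {i : ℕ}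
    (hi : i + 1 ≤ D.weight z) (m : V →₀ ℕ) :
    (∃ e ∈ D.truncatedExponents z (i + 1), e ≤ m + Finsupp.single z 1) ↔
      ∃ e ∈ D.truncatedExponents z i, e ≤ m := by
  have hne : ∀ u, u ≠ z → (m + Finsupp.single z 1 : V →₀ ℕ) u = m u := fun u hu => by
    simp [Finsupp.single_eq_of_ne hu]
  have hzz : (m + Finsupp.single z 1 : V →₀ ℕ) z = m z + 1 := by simp
  rw [exists_truncatedExponents_le_iff, exists_truncatedExponents_le_iff, hzz]
  constructor
  · rintro (⟨u, v, h, hu, hv⟩ | h)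
    · rcases hD.adj_iff.1 h with h' | ⟨-, rfl⟩
      · rw [hne u (by rintro rfl; simp at h')] at hu
        rw [hne v (by rintro rfl; simp at h')] at hv
        exact Or.inl ⟨u, v, h, hu, hv⟩
      · rw [hzz] at hv
        exact Or.inr (by omega)
    · exact Or.inr (by omega)
  · rintro (⟨u, v, h, hu, hv⟩ | h)
    · exact Or.inl ⟨u, v, h, hu.trans (by simp), hv.trans (by simp)⟩
    · exact Or.inr (by omega)

theorem exists_truncatedExponents_succ_le_or_iff (i : ℕ) (m : V →₀ ℕ) :
    ((∃ e ∈ D.truncatedExponents z (i + 1), e ≤ m) ∨ Finsupp.single z 1 ≤ m) ↔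
      ∃ e ∈ D.truncatedExponents z 1, e ≤ m := by
  rw [exists_truncatedExponents_le_iff, exists_truncatedExponents_le_iff, Finsupp.single_le_iff,
    or_assoc]
  exact or_congr_right ⟨fun h => by omega, Or.inr⟩

/-- Dividing by `z^w` turns the edges into `z` into the variables of `X` and `y`. These absorb every
other edge meeting `X`, leaving `D_F` and the free variable `z`. -/
theorem exists_edgeExponents_le_add_iff (hD : D.IsWhiskeredSink z y X) (m : V →₀ ℕ) :
    (∃ e ∈ D.edgeExponents, e ≤ m + Finsupp.single z (D.weight z)) ↔
      ∃ e ∈ D.deletionExponents ({z, y} ∪ X) z, e ≤ m := by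
  have hne : ∀ u, u ≠ z → (m + Finsupp.single z (D.weight z)) u = m u := fun u hu => by
    simp [Finsupp.single_eq_of_ne hu]
  rw [exists_edgeExponents_le_iff, exists_deletionExponents_le_iff]
  constructor
  · rintro ⟨u, v, h, hu, hv⟩
    rcases hD.adj_iff.1 h with h' | ⟨huX, rfl⟩
    · have huz : u ≠ z := by rintro rfl; simp at h'
      have hvz : v ≠ z := by rintro rfl; simp at h'
      rw [hne u huz] at hu
      rw [hne v hvz] at hv
      by_cases huX : u ∈ X
      · exact Or.inr ⟨u, Or.inr huX, huz, hu⟩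
      · by_cases hvX : v ∈ X
        · exact Or.inr ⟨v, Or.inr hvX, hvz, (D.weight_pos v).trans_le hv⟩
        · exact Or.inl ⟨u, v, h, by simp_all, by simp_all, hu, hv⟩
    · have huz := Adj_ne h
      rw [hne u huz] at hu
      refine Or.inr ⟨u, ?_, huz, hu⟩
      rcases huX with rfl | huX
      · simp
      · exact Or.inr huX
  · rintro (⟨u, v, h, -, -, hu, hv⟩ | ⟨u, hu, huz, h⟩)
    · exact ⟨u, v, h, hu.trans (by simp), hv.trans (by simp)⟩
    · have huX : u ∈ insert y X := by
        rcases hu with hu | hu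
        · simp_all
        · exact Set.mem_insert_of_mem _ hu
      exact ⟨u, z, hD.adj u huX, h.trans (by simp), by simp⟩

theorem exists_edgeExponents_le_or_iff (m : V →₀ ℕ) :
    ((∃ e ∈ D.edgeExponents, e ≤ m) ∨ Finsupp.single z (D.weight z) ≤ m) ↔
      ∃ e ∈ D.truncatedExponents z (D.weight z), e ≤ m := by
  rw [exists_truncatedExponents_le_iff, exists_edgeExponents_le_iff, Finsupp.single_le_iff]

theorem IsWhiskeredSink.hasDepthGE_edgeIdeal (hD : D.IsWhiskeredSink z y X)
    {K : Type*} [Field K] [Finite V] {d : ℕ}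
    (hG : ∀ (p : Ideal (MvPolynomial {v // v ∉ ({z, y} : Set V)} K ⧸
      (D.deleteVerts {z, y}).edgeIdeal K)) [p.IsMaximal],
        HasDepthGE (Localization.AtPrime p) (Localization.AtPrime p) d)
    (hF : ∀ (p : Ideal (MvPolynomial {v // v ∉ ({z, y} ∪ X : Set V)} K ⧸
      (D.deleteVerts ({z, y} ∪ X)).edgeIdeal K)) [p.IsMaximal],
        HasDepthGE (Localization.AtPrime p) (Localization.AtPrime p) d)
    (m : Ideal (MvPolynomial V K)) [m.IsMaximal] :
    HasDepthGE (Localization.AtPrime m) (Localization.AtPrime m ⧸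
      (D.edgeIdeal K).map (algebraMap _ (Localization.AtPrime m))) (d + 1) := by
  have h₀ := hasDepthGE_monomialIdeal_deletionExponents (t := y) (by simp) hG m
  have h₁ : HasDepthGE (Localization.AtPrime m) (Localization.AtPrime m ⧸
      (monomialIdeal K (D.truncatedExponents z 1)).map
        (algebraMap _ (Localization.AtPrime m))) (d + 1) := by
    have : monomialIdeal K (D.truncatedExponents z 1) =
        monomialIdeal K (D.deletionExponents {z, y} y) := by
      ext f
      rw [mem_monomialIdeal, mem_monomialIdeal]
      exact forall₂_congr fun a _ => exists_truncatedExponents_one_le_iff hD a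
    rwa [this]
  have hi : ∀ i, i + 1 ≤ D.weight z → HasDepthGE (Localization.AtPrime m)
      (Localization.AtPrime m ⧸ (monomialIdeal K (D.truncatedExponents z (i + 1))).map
        (algebraMap _ (Localization.AtPrime m))) (d + 1) := by
    intro i
    induction i with
    | zero => exact fun _ => h₁
    | succ i ih =>
      -- The colon by `z` is the previous truncation, and the sum with `(z)` is always the first
      -- one.
      exact fun hle => .monomialIdeal_of_colon m
        (exists_truncatedExponents_succ_le_add_iff hD hle)
        (exists_truncatedExponents_succ_le_or_iff _) (ih (by omega)) h₁
  have hw := hi (D.weight z - 1) (by have := D.weight_pos z; omega)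
  rw [Nat.sub_add_cancel (D.weight_pos z)] at hw
  rw [edgeIdeal_eq_monomialIdeal]
  exact .monomialIdeal_of_colon m (exists_edgeExponents_le_add_iff hD)
    exists_edgeExponents_le_or_iff
    (hasDepthGE_monomialIdeal_deletionExponents (t := z) (by simp) hF m) hw

end Whisker

end WeightedOrientedGraph

/-! ### Counting vertices outside covers, and the conclusion. -/

namespace WeightedOrientedGraph

variable {V : Type*} {D : WeightedOrientedGraph V}

theorem isVertexCover_deleteVerts_preimage {C : Set V} (hC : D.underlying.IsVertexCover C)
    (S : Set V) :
    (D.deleteVerts S).underlying.IsVertexCover ((Subtype.val : {v // v ∉ S} → V) ⁻¹' C) :=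
  fun _ _ h => hC h

theorem isVertexCover_deleteVerts_union {S X : Set V} {C : Set {v // v ∉ S}}
    (hC : (D.deleteVerts S).underlying.IsVertexCover C) :
    (D.deleteVerts (S ∪ X)).underlying.IsVertexCover {v | ⟨v.1, fun h => v.2 (Or.inl h)⟩ ∈ C} :=
  fun _ _ h => hC h

/-- Since `X` lies in `C`, a vertex outside `C` survives the deletion of `X`. -/
theorem card_compl_le_card_compl_union [Finite V] {S X : Set V} {C : Set {v // v ∉ S}}
    (hX : X ⊆ Subtype.val '' C) :
    Nat.card {v // v ∉ C} ≤ Nat.card {v // v ∉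
      {v : {v // v ∉ S ∪ X} | (⟨v.1, fun h => v.2 (Or.inl h)⟩ : {v // v ∉ S}) ∈ C}} := by
  refine Nat.card_le_card_of_injective (fun v => ⟨⟨v.1.1, ?_⟩, v.2⟩) fun v w h => ?_
  · rintro (h | h)
    · exact v.1.2 h
    · obtain ⟨c, hc, hcv⟩ := hX h
      exact v.2 (Subtype.ext hcv ▸ hc)
  · exact Subtype.ext (Subtype.ext (congrArg (fun x => x.1.1) h))

theorem card_compl_le_card_compl_preimage_add_one [Finite V] {C : Set V} {z y : V}
    (h : z ∈ C ∨ y ∈ C) :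
    Nat.card {v // v ∉ C} ≤ Nat.card {v // v ∉
      ((Subtype.val : {v // v ∉ ({z, y} : Set V)} → V) ⁻¹' C)} + 1 := by
  classical
  rw [← Finite.card_option]
  -- At most one of `z` and `y` lies outside `C`; it takes the value `none`.
  refine Nat.card_le_card_of_injective
    (fun v => if hv : v.1 ∈ ({z, y} : Set V) then none else some ⟨⟨v.1, hv⟩, v.2⟩) ?_
  rintro ⟨v, hv⟩ ⟨w, hw⟩ hvw
  by_cases h1 : v ∈ ({z, y} : Set V) <;> by_cases h2 : w ∈ ({z, y} : Set V)
  · simp only [Set.mem_insert_iff, Set.mem_singleton_iff] at h1 h2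
    rw [Subtype.mk.injEq]
    rcases h1 with rfl | rfl <;> rcases h2 with rfl | rfl <;> simp_all
  · simp only [dif_pos h1, dif_neg h2, reduceCtorEq] at hvw
  · simp only [dif_pos h2, dif_neg h1, reduceCtorEq] at hvw
  · simpa only [dif_neg h1, dif_neg h2, Option.some.injEq, Subtype.mk.injEq] using hvw

/-- A weighted oriented graph is Cohen–Macaulay as soon as the localizations of `K[V] ⧸ I(D)`
have depth at least the number of vertices outside any vertex cover. -/
theorem isCohenMacaulay_of_hasDepthGE {K : Type*} [Field K] [Finite V] {d : ℕ}
    (hdim : ∀ C : Set V, D.underlying.IsVertexCover C → Nat.card {v // v ∉ C} ≤ d)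
    (h : ∀ (m : Ideal (MvPolynomial V K)) [m.IsMaximal],
      HasDepthGE (Localization.AtPrime m) (Localization.AtPrime m ⧸
        (D.edgeIdeal K).map (algebraMap _ (Localization.AtPrime m))) d) :
    D.IsCohenMacaulay K := by
  have hn : IsNoetherianRing (MvPolynomial V K ⧸ D.edgeIdeal K) := inferInstance
  refine ⟨hn, fun p hp => ?_⟩
  have := IsLocalization.isNoetherianRing p.primeCompl (Localization.AtPrime p) hn
  have hm : (p.comap (Ideal.Quotient.mk (D.edgeIdeal K))).IsMaximal :=
    Ideal.comap_isMaximal_of_surjective _ Ideal.Quotient.mk_surjective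
  refine .of_hasDepthGE (d := d) ?_ ?_
  · refine (hasDepthGE_localization_quotient_iff (Ideal.Quotient.mk (D.edgeIdeal K))
      Ideal.Quotient.mk_surjective p _ rfl d).1 ?_
    rw [Ideal.mk_ker]
    exact h _
  · rw [IsLocalization.AtPrime.ringKrullDim_eq_height p]
    exact (Ideal.height_le_ringKrullDim_of_isPrime).trans (ringKrullDim_quotient_edgeIdeal_le hdim)

end WeightedOrientedGraph

theorem proposition3p2 {K : Type*} [Field K] {V : Type*} [Finite V]
    (DH : WeightedOrientedGraph V) (z y : V)
    -- `y` has degree one, `z` has degree at least two, and `(y, z)` is an edge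
    (hy : (DH.underlying.neighborSet y).ncard = 1)
    (hz : 2 ≤ (DH.underlying.neighborSet z).ncard)
    (hyz : DH.Adj y z)
    -- `X = {x₁, …, x_k}` is the set of neighbours of `z` other than `y`, all edges pointing to `z`
    (X : Set V) (hX : X = DH.underlying.neighborSet z \ {y})
    (hXz : ∀ x ∈ X, DH.Adj x z)
    -- `X` lies in a minimal vertex cover of the graph underlying `D_G = D_H ∖ {z, y}`
    (hcover : ∃ C : Set {v : V // v ∉ ({z, y} : Set V)},
      Minimal (DH.deleteVerts {z, y}).underlying.IsVertexCover C ∧ X ⊆ Subtype.val '' C)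
    -- `D_G` and `D_F = D_G ∖ X` are Cohen–Macaulay
    (hG : (DH.deleteVerts {z, y}).IsCohenMacaulay K)
    (hF : (DH.deleteVerts ({z, y} ∪ X)).IsCohenMacaulay K) :
    DH.IsCohenMacaulay K := by
  obtain ⟨C, hC, hXC⟩ := hcover
  have hsink : DH.IsWhiskeredSink z y X := by
    refine ⟨fun u hu => ?_, fun u hu => ?_, ?_⟩
    · by_cases huy : u = y
      · exact Or.inl huy
      · exact Or.inr (hX ▸ ⟨hu, huy⟩)
    · obtain ⟨a, ha⟩ := Set.ncard_eq_one.1 hy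
      have h₁ : u ∈ DH.underlying.neighborSet y := hu
      have h₂ : z ∈ DH.underlying.neighborSet y := Or.inl hyz
      rw [ha] at h₁ h₂
      exact h₁.trans h₂.symm
    · rintro x (rfl | hx)
      · exact hyz
      · exact hXz x hx
  refine WeightedOrientedGraph.isCohenMacaulay_of_hasDepthGE (d := Nat.card {v // v ∉ C} + 1)
    (fun B hB => ?_) fun m _ => hsink.hasDepthGE_edgeIdeal (fun p _ => hG.hasDepthGE hC.1 p)
      (fun p _ => ?_) m
  · exact (WeightedOrientedGraph.card_compl_le_card_compl_preimage_add_one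
      (hB (Or.inr hyz : DH.underlying.Adj z y))).trans (Nat.add_le_add_right (hG.card_compl_le hC
        (WeightedOrientedGraph.isVertexCover_deleteVerts_preimage hB _)) 1)
  -- Here `X ⊆ C` enters: passing to `F` loses none of the vertices outside `C`.
  · exact (hF.hasDepthGE (WeightedOrientedGraph.isVertexCover_deleteVerts_union hC.1) p).mono
      (WeightedOrientedGraph.card_compl_le_card_compl_union hXC)
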